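/- Let $L\ge 2$ be an integer and let $P,N>0$ be real numbers with $\frac NP\le\frac{L-1}{L}$. For a list of $L$ distinct points $x_1,\dots,x_L\in\mathbb R^n$ with centroid $\bar x=\frac1L\sum_i x_i$ put $\overline{\mathrm{rad}}^2(x_1,\dots,x_L)=\frac1L\sum_{i=1}^L\|x_i-\bar x\|_2^2$. A set $\mathcal C\subseteq\{x\in\mathbb R^n:\|x\|_2\le\sqrt{nP}\}$ is called $(P,N,L-1)$-average-radius list-decodable if the minimum of $\overline{\mathrm{rad}}^2$ over all $L$-element subsets of $\mathcal C$ (which is $+\infty$ if there are none) exceeds $nN$. Its rate is $R(\mathcal C)=\frac1n\ln|\mathcal C|$, and the $(P,N,L-1)$-average-radius list-decoding capacity is $$\overline C_{L-1}(P,N)=\limsup_{n\to\infty}\ \sup\{R(\mathcal C):\mathcal C\subset\mathbb R^n\text{ is }(P,N,L-1)\text{-average-radius list-decodable}\}.$$ Let $$B=\frac12\left(1-\frac{LN}{(L-1)P}-\frac1{L-1}\ln\frac{L(P-N)}{P}\right).$$ **Theorem.** (1) $\overline C_{L-1}(P,N)\ge B$. (2) Every rate below $B$ is achieved by expurgated random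 spherical codes: for every real $R<B$, let $M=\lceil e^{nR}\rceil$, sample $M$ independent uniform points from the sphere of radius $\sqrt{nP}$ centred at the origin of $\mathbb R^n$, and let $\mathcal C$ be the set of these points. Then, with probability tending to $1$ as $n\to\infty$, every code $\mathcal C'$ obtained from $\mathcal C$ by removing one (arbitrarily chosen) point of each $L$-element subset of $\mathcal C$ with $\overline{\mathrm{rad}}^2\le nN$ is $(P,N,L-1)$-average-radius list-decodable and satisfies $|\mathcal C'|\ge M/2$ (hence has rate at least $R-\frac{\ln 2}{n}$). -/

import Mathlib

open MeasureTheory Filter Topology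
open scoped ENNReal

namespace MultiplePacking

/-- Euclidean space `ℝⁿ` with the `ℓ₂` norm. -/
abbrev Pt (n : ℕ) : Type := EuclideanSpace ℝ (Fin n)

/-- The centroid of a finite list of points. -/
noncomputable def centroid {n : ℕ} (S : Finset (Pt n)) : Pt n :=
  (S.card : ℝ)⁻¹ • ∑ x ∈ S, x

/-- The average squared radius of a list: the average squared distance to its centroid. -/
noncomputable def avgRadSq {n : ℕ} (S : Finset (Pt n)) : ℝ :=
  (S.card : ℝ)⁻¹ * ∑ x ∈ S, ‖x - centroid S‖ ^ 2

/-- The `L`-lists of a code, i.e. its subsets of size `L`. -/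
def lists {n : ℕ} (L : ℕ) (C : Set (Pt n)) : Set (Finset (Pt n)) :=
  {S | (S : Set (Pt n)) ⊆ C ∧ S.card = L}

/-- The `(L-1)`-average squared radius of a code: the minimum of the average squared radius over
its `L`-lists (it is `⊤` if there are none). -/
noncomputable def codeAvgRadSq {n : ℕ} (L : ℕ) (C : Set (Pt n)) : EReal :=
  ⨅ S ∈ lists L C, (avgRadSq S : EReal)

/-- `(P, N, L-1)`-average-radius list-decodable codes in `ℝⁿ`. -/
def IsAvgRadListDecodable {n : ℕ} (P N : ℝ) (L : ℕ) (C : Set (Pt n)) : Prop :=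
  C ⊆ Metric.closedBall 0 (Real.sqrt (n * P)) ∧ ((n * N : ℝ) : EReal) < codeAvgRadSq L C

/-- The rate `(1/n) ln |C|` of a code (`⊤` if `C` is infinite, `⊥` if it is empty, for `n ≥ 1`). -/
noncomputable def rate {n : ℕ} (C : Set (Pt n)) : EReal :=
  ENNReal.log (C.encard : ℝ≥0∞) / (n : EReal)

/-- The `(P, N, L-1)`-average-radius list-decoding capacity. -/
noncomputable def avgRadCapacity (P N : ℝ) (L : ℕ) : EReal :=
  limsup (fun n : ℕ => ⨆ C ∈ {C : Set (Pt n) | IsAvgRadListDecodable P N L C}, rate C) atTop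

/-- The uniform distribution on the unit sphere of `ℝⁿ`: normalized surface measure. -/
noncomputable def uniformSphere (n : ℕ) : Measure (Metric.sphere (0 : Pt n) 1) :=
  ((volume : Measure (Pt n)).toSphere Set.univ)⁻¹ • (volume : Measure (Pt n)).toSphere

/-- The law of `M` independent uniform points of the unit sphere of `ℝⁿ`. -/
noncomputable def sphereSample (n M : ℕ) : Measure (Fin M → Metric.sphere (0 : Pt n) 1) :=
  Measure.pi fun _ => uniformSphere n

/-- The spherical code `{√(nP) u₁, …, √(nP) u_M}` of power `P` given by unit vectors `u₁, …, u_M`. -/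
noncomputable def sphericalCode {n M : ℕ} (P : ℝ) (u : Fin M → Metric.sphere (0 : Pt n) 1) :
    Set (Pt n) :=
  Set.range fun i => Real.sqrt (n * P) • (u i : Pt n)

/-- The bad `L`-lists of a code: those whose average squared radius is at most `nN`. -/
def badLists {n : ℕ} (N : ℝ) (L : ℕ) (C : Set (Pt n)) : Set (Finset (Pt n)) :=
  {S ∈ lists L C | avgRadSq S ≤ n * N}

/-- `C'` is an expurgation of `C`: one point of each bad `L`-list of `C` has been removed. -/
def IsExpurgation {n : ℕ} (N : ℝ) (L : ℕ) (C C' : Set (Pt n)) : Prop :=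
  ∃ c : Finset (Pt n) → Pt n, (∀ S ∈ badLists N L C, c S ∈ S) ∧ C' = C \ (c '' badLists N L C)

end MultiplePacking

/-!
Put `t = L (P - N) / P`, which is at least `1`. For points `√(nP) uᵢ` with unit vectors `uᵢ`, the
average squared radius of an `L`-list is `nP (1 - ‖∑ uᵢ‖² / L²)`, so the list is bad exactly when
`‖∑ uᵢ‖² ≥ L t`.

A standard Gaussian vector is the product of its norm and an independent uniform unit vector `u`.
Jensen's inequality applied to the norm bounds the moment generating function `𝔼 exp ⟪h, u⟫` by
`exp (‖h‖² / (2m²))`, where `m` is the mean of the norm, and `m² ≥ n - 1` by log-convexity of the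
Gamma function. Hence `u` is sub-Gaussian with variance proxy `1 / (n - 1)`, and a sum of `L`
independent copies is sub-Gaussian with proxy `L / (n - 1)`. Averaging its moment generating
function over a Gaussian argument controls the exponential moments of the squared norm, and a
Chernoff bound shows that a list is bad with probability `O(exp (-n (t - 1 - log t) / 2))`.

There are at most about `M ^ L` lists, so the expected number of bad ones is `o(M)` for
`M = ⌈exp (nR)⌉` as soon as `(L - 1) R < (t - 1 - log t) / 2`, that is `R < B`, and by Markov's
inequality fewer than `M / 2` points are removed, with probability tending to one.
-/

namespace MultiplePacking

open ProbabilityTheory Module Metric Set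
open scoped NNReal RealInnerProductSpace

section Gaussian

variable {E : Type*} [NormedAddCommGroup E] [InnerProductSpace ℝ E] [FiniteDimensional ℝ E]
  [MeasurableSpace E] [BorelSpace E]

lemma integrable_exp_neg_mul_sq_norm {b : ℝ} (hb : 0 < b) :
    Integrable fun x : E => Real.exp (-b * ‖x‖ ^ 2) := by
  refine .of_integral_ne_zero ?_
  rw [GaussianFourier.integral_rexp_neg_mul_sq_norm hb]
  positivity

variable (E) in
/-- The density of the standard Gaussian measure of `E` with respect to Lebesgue measure, as a
function of the norm. -/
noncomputable def gaussianRadialPDF (r : ℝ) : ℝ :=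
  (2 * Real.pi) ^ (-(finrank ℝ E / 2 : ℝ)) * Real.exp (-(1 / 2) * r ^ 2)

omit [FiniteDimensional ℝ E] [MeasurableSpace E] [BorelSpace E] in
lemma gaussianRadialPDF_pos (r : ℝ) : 0 < gaussianRadialPDF E r := by
  unfold gaussianRadialPDF; positivity

omit [FiniteDimensional ℝ E] [MeasurableSpace E] [BorelSpace E] in
@[fun_prop] lemma measurable_gaussianRadialPDF : Measurable (gaussianRadialPDF E) := by
  unfold gaussianRadialPDF; fun_prop

lemma integrable_gaussianRadialPDF_norm : Integrable fun x : E => gaussianRadialPDF E ‖x‖ :=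
  (integrable_exp_neg_mul_sq_norm (by norm_num)).const_mul _

theorem stdGaussian_eq_withDensity :
    stdGaussian E = volume.withDensity fun x => ENNReal.ofReal (gaussianRadialPDF E ‖x‖) := by
  have := isFiniteMeasure_withDensity_ofReal (integrable_gaussianRadialPDF_norm (E := E)).2
  refine Measure.ext_of_charFun (funext fun t => ?_)
  rw [charFun_stdGaussian, charFun_apply, integral_withDensity_eq_integral_toReal_smul
    (by fun_prop) (.of_forall fun _ => ENNReal.ofReal_lt_top)]
  have hfourier := GaussianFourier.integral_cexp_neg_mul_sq_norm_add (V := E) (b := 1 / 2)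
    (by norm_num) Complex.I t
  have hnorm : (2 * Real.pi : ℂ) ^ (-(finrank ℝ E / 2 : ℂ)) *
      (2 * Real.pi : ℂ) ^ (finrank ℝ E / 2 : ℂ) = 1 := by
    rw [← Complex.cpow_add _ _ (by norm_num [Real.pi_ne_zero]), neg_add_cancel, Complex.cpow_zero]
  have hbase : (Real.pi / (1 / 2) : ℂ) = 2 * Real.pi := by ring
  calc Complex.exp (-‖t‖ ^ 2 / 2)
    _ = (2 * Real.pi : ℂ) ^ (-(finrank ℝ E / 2 : ℂ)) *
        ∫ x : E, Complex.exp (-(1 / 2) * ‖x‖ ^ 2 + Complex.I * ⟪t, x⟫) := by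
      rw [hfourier, hbase, ← mul_assoc, hnorm, Complex.I_sq]
      ring_nf
    _ = _ := by
      rw [← integral_const_mul]
      refine integral_congr_ae (.of_forall fun x => ?_)
      have h2pi : (0 : ℝ) ≤ 2 * Real.pi := by positivity
      beta_reduce
      rw [ENNReal.toReal_ofReal (gaussianRadialPDF_pos _).le, gaussianRadialPDF,
        Complex.real_smul, Complex.exp_add, real_inner_comm]
      push_cast [Complex.ofReal_cpow h2pi]
      ring_nf

theorem lintegral_exp_inner_stdGaussian (w : E) :
    ∫⁻ x, ENNReal.ofReal (Real.exp ⟪w, x⟫) ∂stdGaussian E =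
      ENNReal.ofReal (Real.exp (‖w‖ ^ 2 / 2)) := by
  have hmap : (stdGaussian E).map (innerSL ℝ w) = gaussianReal 0 (‖w‖₊ ^ 2) := by
    rw [IsGaussian.map_eq_gaussianReal, variance_dual_stdGaussian, innerSL_apply_norm,
      integral_strongDual_stdGaussian, ← coe_nnnorm, ← NNReal.coe_pow, Real.toNNReal_coe]
  calc ∫⁻ x, ENNReal.ofReal (Real.exp ⟪w, x⟫) ∂stdGaussian E
    _ = ∫⁻ r, ENNReal.ofReal (Real.exp (1 * r)) ∂gaussianReal 0 (‖w‖₊ ^ 2) := by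
      rw [← hmap, lintegral_map (by fun_prop) (by fun_prop)]
      simp only [one_mul, innerSL_apply_apply]
    _ = ENNReal.ofReal (mgf id (gaussianReal 0 (‖w‖₊ ^ 2)) 1) :=
      (ofReal_integral_eq_lintegral_ofReal (integrable_exp_mul_gaussianReal 1)
        (.of_forall fun _ => (Real.exp_pos _).le)).symm
    _ = ENNReal.ofReal (Real.exp (‖w‖ ^ 2 / 2)) := by simp [mgf_id_gaussianReal]

theorem lintegral_exp_mul_sq_norm_stdGaussian {a : ℝ} (ha : a < 1) :
    ∫⁻ x, ENNReal.ofReal (Real.exp (a * ‖x‖ ^ 2 / 2)) ∂stdGaussian E =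
      ENNReal.ofReal ((1 - a) ^ (-(finrank ℝ E / 2 : ℝ))) := by
  have h1a : 0 < 1 - a := sub_pos.2 ha
  have hb : 0 < (1 - a) / 2 := half_pos h1a
  calc ∫⁻ x, ENNReal.ofReal (Real.exp (a * ‖x‖ ^ 2 / 2)) ∂stdGaussian E
    _ = ∫⁻ x : E, ENNReal.ofReal
          ((2 * Real.pi) ^ (-(finrank ℝ E / 2 : ℝ)) * Real.exp (-((1 - a) / 2) * ‖x‖ ^ 2)) := by
      rw [stdGaussian_eq_withDensity, lintegral_withDensity_eq_lintegral_mul _ (by fun_prop)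
        (by fun_prop)]
      refine lintegral_congr fun x => ?_
      rw [Pi.mul_apply, ← ENNReal.ofReal_mul (gaussianRadialPDF_pos _).le, gaussianRadialPDF,
        mul_assoc, ← Real.exp_add]
      ring_nf
    _ = ENNReal.ofReal ((2 * Real.pi) ^ (-(finrank ℝ E / 2 : ℝ)) *
          (Real.pi / ((1 - a) / 2)) ^ (finrank ℝ E / 2 : ℝ)) := by
      rw [← GaussianFourier.integral_rexp_neg_mul_sq_norm hb, ← integral_const_mul,
        ofReal_integral_eq_lintegral_ofReal ((integrable_exp_neg_mul_sq_norm hb).const_mul _)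
          (.of_forall fun _ => by positivity)]
    _ = ENNReal.ofReal ((1 - a) ^ (-(finrank ℝ E / 2 : ℝ))) := by
      rw [Real.rpow_neg (by positivity), Real.rpow_neg h1a.le, ← Real.inv_rpow (by positivity),
        ← Real.inv_rpow h1a.le, ← Real.mul_rpow (by positivity) (by positivity)]
      congr 2
      field_simp

lemma integral_pow_mul_exp_neg_sq (k : ℕ) :
    ∫ r in Ioi (0 : ℝ), r ^ k * Real.exp (-(1 / 2) * r ^ 2) =
      (1 / 2 : ℝ) ^ (-((k : ℝ) + 1) / 2) * (1 / 2) * Real.Gamma (((k : ℝ) + 1) / 2) := by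
  have := integral_rpow_mul_exp_neg_mul_rpow (p := 2) (q := k) (b := 1 / 2) (by norm_num)
    (by linarith [k.cast_nonneg (α := ℝ)]) (by norm_num)
  simpa using this

lemma integral_pow_norm_stdGaussian [Nontrivial E] (k : ℕ) :
    ∫ x, ‖x‖ ^ k ∂stdGaussian E =
      finrank ℝ E * volume.real (ball (0 : E) 1) * (2 * Real.pi) ^ (-(finrank ℝ E / 2 : ℝ)) *
        ∫ r in Ioi (0 : ℝ), r ^ (finrank ℝ E - 1 + k) * Real.exp (-(1 / 2) * r ^ 2) := by
  rw [stdGaussian_eq_withDensity, integral_withDensity_eq_integral_toReal_smul (by fun_prop)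
    (.of_forall fun _ => ENNReal.ofReal_lt_top)]
  simp only [ENNReal.toReal_ofReal (gaussianRadialPDF_pos _).le]
  rw [integral_fun_norm_addHaar volume fun r => gaussianRadialPDF E r • r ^ k,
    nsmul_eq_mul, smul_eq_mul, mul_assoc, mul_assoc,
    ← integral_const_mul ((2 * Real.pi) ^ (-(finrank ℝ E / 2 : ℝ)))]
  refine congrArg _ (congrArg _ (integral_congr_ae (.of_forall fun r => ?_)))
  simp only [gaussianRadialPDF, smul_eq_mul, pow_add]
  ring

variable (E) in
theorem integral_norm_stdGaussian [Nontrivial E] :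
    ∫ x, ‖x‖ ∂stdGaussian E =
      √2 * Real.Gamma ((finrank ℝ E + 1) / 2) / Real.Gamma (finrank ℝ E / 2) := by
  have hn : ((finrank ℝ E - 1 : ℕ) : ℝ) + 1 = finrank ℝ E := by
    exact_mod_cast Nat.succ_pred finrank_pos.ne'
  have hmass := integral_pow_norm_stdGaussian (E := E) 0
  have hmean := integral_pow_norm_stdGaussian (E := E) 1
  simp only [pow_zero, pow_one, integral_const, probReal_univ, smul_eq_mul, mul_one, add_zero,
    integral_pow_mul_exp_neg_sq, Nat.cast_add, Nat.cast_one, hn] at hmass hmean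
  have hG : 0 < Real.Gamma (finrank ℝ E / 2) := Real.Gamma_pos_of_pos <| by
    have := finrank_pos (R := ℝ) (M := E)
    positivity
  have hsqrt : (1 / 2 : ℝ) ^ (-(finrank ℝ E + 1 : ℝ) / 2) =
      (1 / 2 : ℝ) ^ (-(finrank ℝ E : ℝ) / 2) * √2 := by
    rw [neg_add, add_div, Real.rpow_add (by norm_num), neg_div 2 (1 : ℝ),
      Real.rpow_neg (by norm_num) (1 / 2), ← Real.inv_rpow (by norm_num), one_div, inv_inv,
      ← one_div, Real.sqrt_eq_rpow]
  rw [eq_div_iff hG.ne', hmean, hsqrt]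
  linear_combination -√2 * Real.Gamma ((finrank ℝ E + 1) / 2) * hmass

lemma sub_half_mul_sq_Gamma_le (x : ℝ) :
    (x - 1 / 2) * Real.Gamma x ^ 2 ≤ Real.Gamma (x + 1 / 2) ^ 2 := by
  obtain hx | hx := le_or_gt x (1 / 2)
  · nlinarith [sq_nonneg (Real.Gamma x), sq_nonneg (Real.Gamma (x + 1 / 2))]
  have hs : 0 < x - 1 / 2 := sub_pos.2 hx
  have hG : 0 < Real.Gamma (x - 1 / 2) := Real.Gamma_pos_of_pos hs
  have hG' : Real.Gamma (x + 1 / 2) = (x - 1 / 2) * Real.Gamma (x - 1 / 2) := by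
    rw [← Real.Gamma_add_one hs.ne']
    ring_nf
  -- Log-convexity of `Γ`: `x` is the midpoint of `x - 1 / 2` and `x + 1 / 2`.
  have hconv := Real.Gamma_mul_add_mul_le_rpow_Gamma_mul_rpow_Gamma (s := x - 1 / 2)
    (t := x + 1 / 2) (a := 1 / 2) (b := 1 / 2) hs (by linarith) (by norm_num) (by norm_num)
    (by norm_num)
  rw [show 1 / 2 * (x - 1 / 2) + 1 / 2 * (x + 1 / 2) = x by ring,
    ← Real.sqrt_eq_rpow, ← Real.sqrt_eq_rpow, ← Real.sqrt_mul hG.le] at hconv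
  have hsq : Real.Gamma x ^ 2 ≤ Real.Gamma (x - 1 / 2) * Real.Gamma (x + 1 / 2) :=
    (Real.le_sqrt' (Real.Gamma_pos_of_pos (by linarith))).1 hconv
  calc (x - 1 / 2) * Real.Gamma x ^ 2
    _ ≤ (x - 1 / 2) * (Real.Gamma (x - 1 / 2) * Real.Gamma (x + 1 / 2)) := by gcongr
    _ = Real.Gamma (x + 1 / 2) ^ 2 := by rw [← mul_assoc, ← hG', sq]

variable (E) in
theorem finrank_sub_one_le_sq_integral_norm_stdGaussian [Nontrivial E] :
    (finrank ℝ E : ℝ) - 1 ≤ (∫ x, ‖x‖ ∂stdGaussian E) ^ 2 := by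
  have hG : 0 < Real.Gamma (finrank ℝ E / 2) := Real.Gamma_pos_of_pos <| by
    have := finrank_pos (R := ℝ) (M := E)
    positivity
  rw [integral_norm_stdGaussian, div_pow, mul_pow, Real.sq_sqrt (by norm_num),
    le_div_iff₀ (by positivity), add_div]
  linarith [sub_half_mul_sq_Gamma_le (finrank ℝ E / 2)]

end Gaussian

section Polar

variable {E : Type*} [NormedAddCommGroup E] [NormedSpace ℝ E] [FiniteDimensional ℝ E]
  [Nontrivial E] [MeasurableSpace E] [BorelSpace E] (μ : Measure E) [μ.IsAddHaarMeasure]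

theorem lintegral_eq_lintegral_toSphere {f : E → ℝ≥0∞} (hf : Measurable f) :
    ∫⁻ x, f x ∂μ = ∫⁻ u : sphere (0 : E) 1, (∫⁻ r in Ioi (0 : ℝ),
      ENNReal.ofReal (r ^ (finrank ℝ E - 1)) * f (r • (u : E))) ∂μ.toSphere := by
  calc ∫⁻ x, f x ∂μ
    _ = ∫⁻ x : ({0}ᶜ : Set E), f x ∂Measure.comap Subtype.val μ := by
      rw [lintegral_subtype_comap (measurableSet_singleton _).compl, restrict_compl_singleton]
    _ = ∫⁻ p, f (p.2.1 • (p.1 : E))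
          ∂μ.toSphere.prod (Measure.volumeIoiPow (finrank ℝ E - 1)) := by
      rw [← μ.measurePreserving_homeomorphUnitSphereProd.lintegral_comp (by fun_prop)]
      refine lintegral_congr fun x => ?_
      simp [smul_smul, norm_ne_zero_iff.2 x.2]
    _ = _ := by
      rw [lintegral_prod _ (by fun_prop)]
      refine lintegral_congr fun u => ?_
      rw [Measure.volumeIoiPow, lintegral_withDensity_eq_lintegral_mul _ (by fun_prop)
        (by fun_prop)]
      exact lintegral_subtype_comap measurableSet_Ioi fun r =>
        ENNReal.ofReal (r ^ (finrank ℝ E - 1)) * f (r • (u : E))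

/-- The measure `φ r * r ^ k dr` on the positive half-line. For `k = finrank ℝ E - 1` it is, up to
a constant, the law of the norm under the radial measure `φ ‖x‖ dx` on `E`. -/
noncomputable def radialMeasure (φ : ℝ → ℝ≥0∞) (k : ℕ) : Measure ℝ :=
  (volume.restrict (Ioi 0)).withDensity fun r => ENNReal.ofReal (r ^ k) * φ r

lemma lintegral_withDensity_norm_eq_lintegral_toSphere {φ : ℝ → ℝ≥0∞} (hφ : Measurable φ)
    {f : E → ℝ≥0∞} (hf : Measurable f) :
    ∫⁻ x, f x ∂μ.withDensity (fun x => φ ‖x‖) = ∫⁻ u : sphere (0 : E) 1,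
      ∫⁻ r, f (r • (u : E)) ∂radialMeasure φ (finrank ℝ E - 1) ∂μ.toSphere := by
  rw [lintegral_withDensity_eq_lintegral_mul _ (by fun_prop) hf,
    lintegral_eq_lintegral_toSphere μ (by fun_prop)]
  refine lintegral_congr fun u => ?_
  rw [radialMeasure, lintegral_withDensity_eq_lintegral_mul _ (by fun_prop) (by fun_prop)]
  refine setLIntegral_congr_fun measurableSet_Ioi fun r hr => ?_
  simp [norm_smul, abs_of_pos (mem_Ioi.1 hr), mul_assoc]

lemma map_norm_withDensity_norm {φ : ℝ → ℝ≥0∞} (hφ : Measurable φ) :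
    (μ.withDensity fun x => φ ‖x‖).map norm =
      μ.toSphere univ • radialMeasure φ (finrank ℝ E - 1) := by
  refine Measure.ext fun s hs => ?_
  have habs : ∀ᵐ r ∂radialMeasure φ (finrank ℝ E - 1), |r| = r :=
    (withDensity_absolutelyContinuous _ _).ae_le <|
      (ae_restrict_mem measurableSet_Ioi).mono fun r hr => abs_of_pos hr
  rw [← lintegral_indicator_one hs, lintegral_map (by fun_prop) (by fun_prop),
    lintegral_withDensity_norm_eq_lintegral_toSphere μ hφ (by fun_prop)]
  simp only [norm_smul, norm_eq_of_mem_sphere, mul_one, Real.norm_eq_abs, lintegral_const]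
  rw [lintegral_congr_ae (habs.mono fun r hr => congrArg (s.indicator 1) hr),
    lintegral_indicator_one hs, Measure.smul_apply, smul_eq_mul, mul_comm]

theorem lintegral_withDensity_norm_eq_laverage_toSphere {φ : ℝ → ℝ≥0∞} (hφ : Measurable φ)
    {f : E → ℝ≥0∞} (hf : Measurable f) :
    ∫⁻ x, f x ∂μ.withDensity (fun x => φ ‖x‖) = ⨍⁻ u : sphere (0 : E) 1,
      ∫⁻ r, f (r • (u : E)) ∂(μ.withDensity fun x => φ ‖x‖).map norm ∂μ.toSphere := by
  have h0 : μ.toSphere univ ≠ 0 := by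
    simpa only [ne_eq, Measure.measure_univ_eq_zero] using μ.toSphere_ne_zero
  rw [lintegral_withDensity_norm_eq_lintegral_toSphere μ hφ hf, map_norm_withDensity_norm μ hφ]
  simp only [lintegral_smul_measure, laverage, smul_eq_mul]
  rw [lintegral_const_mul' _ _ (measure_ne_top _ _), ← mul_assoc,
    ENNReal.inv_mul_cancel h0 (measure_ne_top _ _), one_mul]

end Polar

theorem ofReal_exp_integral_le_lintegral {α : Type*} [MeasurableSpace α] {ν : Measure α}
    [IsProbabilityMeasure ν] {X : α → ℝ} (hX : Integrable X ν) :
    ENNReal.ofReal (Real.exp (∫ x, X x ∂ν)) ≤ ∫⁻ x, ENNReal.ofReal (Real.exp (X x)) ∂ν := by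
  have hmeas : AEStronglyMeasurable (fun x => Real.exp (X x)) ν :=
    Real.continuous_exp.comp_aestronglyMeasurable hX.1
  by_cases hexp : Integrable (fun x => Real.exp (X x)) ν
  · rw [← ofReal_integral_eq_lintegral_ofReal hexp (.of_forall fun x => (Real.exp_pos _).le)]
    exact ENNReal.ofReal_le_ofReal <| convexOn_exp.map_integral_le Real.continuous_exp.continuousOn
      isClosed_univ (.of_forall fun _ => mem_univ _) hX hexp
  · rw [← lintegral_ofReal_ne_top_iff_integrable hmeas (.of_forall fun x => (Real.exp_pos _).le),
      not_not] at hexp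
    exact hexp ▸ le_top

section Subgaussian

variable {Ω Ω' E : Type*} {mΩ : MeasurableSpace Ω} {mΩ' : MeasurableSpace Ω'}
  [NormedAddCommGroup E] [InnerProductSpace ℝ E]

/-- A random vector is sub-Gaussian with variance proxy `c` if each of its one-dimensional
marginals `⟪w, X⟫` is sub-Gaussian with variance proxy `c * ‖w‖ ^ 2`. -/
def IsSubgaussianVector (X : Ω → E) (c : ℝ≥0) (μ : Measure Ω) : Prop :=
  ∀ w : E, HasSubgaussianMGF (fun ω => ⟪w, X ω⟫) (c * ‖w‖₊ ^ 2) μ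

namespace IsSubgaussianVector

variable {X : Ω → E} {c : ℝ≥0} {μ : Measure Ω}

lemma of_map {Y : Ω' → Ω} {ν : Measure Ω'} (hY : AEMeasurable Y ν)
    (h : IsSubgaussianVector X c (ν.map Y)) : IsSubgaussianVector (X ∘ Y) c ν :=
  fun w => HasSubgaussianMGF.of_map (X := fun x => ⟪w, X x⟫) hY (h w)

lemma lintegral_exp_inner_le (h : IsSubgaussianVector X c μ) (w : E) :
    ∫⁻ ω, ENNReal.ofReal (Real.exp ⟪w, X ω⟫) ∂μ ≤
      ENNReal.ofReal (Real.exp (c * ‖w‖ ^ 2 / 2)) := by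
  have hint : Integrable (fun ω => Real.exp ⟪w, X ω⟫) μ := by
    simpa using (h w).integrable_exp_mul 1
  rw [← ofReal_integral_eq_lintegral_ofReal hint (.of_forall fun _ => (Real.exp_pos _).le)]
  exact ENNReal.ofReal_le_ofReal (by simpa [mgf] using (h w).mgf_le 1)

variable [MeasurableSpace E] [BorelSpace E]

lemma of_lintegral_exp_inner_le [SecondCountableTopology E] (hX : AEMeasurable X μ)
    (h : ∀ w : E, ∫⁻ ω, ENNReal.ofReal (Real.exp ⟪w, X ω⟫) ∂μ ≤
      ENNReal.ofReal (Real.exp (c * ‖w‖ ^ 2 / 2))) :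
    IsSubgaussianVector X c μ := by
  intro w
  have hmul (t : ℝ) : ∫⁻ ω, ENNReal.ofReal (Real.exp (t * ⟪w, X ω⟫)) ∂μ ≤
      ENNReal.ofReal (Real.exp ((c * ‖w‖₊ ^ 2 : ℝ≥0) * t ^ 2 / 2)) := by
    have hw := h (t • w)
    simp only [real_inner_smul_left, norm_smul, mul_pow, Real.norm_eq_abs, sq_abs] at hw
    convert hw using 3
    push_cast
    ring
  have hint (t : ℝ) : Integrable (fun ω => Real.exp (t * ⟪w, X ω⟫)) μ := by
    refine (lintegral_ofReal_ne_top_iff_integrable (AEMeasurable.aestronglyMeasurable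
      (by fun_prop)) (.of_forall fun _ => (Real.exp_pos _).le)).1 ?_
    exact ((hmul t).trans_lt ENNReal.ofReal_lt_top).ne
  refine ⟨hint, fun t => ?_⟩
  rw [← ENNReal.ofReal_le_ofReal_iff (Real.exp_pos _).le, mgf,
    ofReal_integral_eq_lintegral_ofReal (hint t) (.of_forall fun _ => (Real.exp_pos _).le)]
  exact hmul t

lemma sum_of_iIndepFun {ι : Type*} {X : ι → Ω → E} (hindep : iIndepFun X μ) {c : ι → ℝ≥0}
    {s : Finset ι} (h : ∀ i ∈ s, IsSubgaussianVector (X i) (c i) μ) :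
    IsSubgaussianVector (fun ω => ∑ i ∈ s, X i ω) (∑ i ∈ s, c i) μ := by
  intro w
  simp only [inner_sum, Finset.sum_mul]
  exact .sum_of_iIndepFun (hindep.comp (fun _ x => ⟪w, x⟫) fun _ => by fun_prop)
    fun i hi => h i hi w

variable [FiniteDimensional ℝ E] [SFinite μ]

theorem lintegral_exp_mul_sq_norm_le (h : IsSubgaussianVector X c μ) (hX : AEMeasurable X μ)
    {a : ℝ} (ha : 0 ≤ a) (hca : c * a < 1) :
    ∫⁻ ω, ENNReal.ofReal (Real.exp (a * ‖X ω‖ ^ 2 / 2)) ∂μ ≤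
      ENNReal.ofReal ((1 - c * a) ^ (-(finrank ℝ E / 2 : ℝ))) := by
  have hlin (x : E) : ENNReal.ofReal (Real.exp (a * ‖x‖ ^ 2 / 2)) =
      ∫⁻ g, ENNReal.ofReal (Real.exp ⟪√a • g, x⟫) ∂stdGaussian E := by
    have hswap (g : E) : ⟪√a • g, x⟫ = ⟪√a • x, g⟫ := by
      rw [real_inner_smul_left, real_inner_smul_left, real_inner_comm]
    simp only [hswap]
    rw [lintegral_exp_inner_stdGaussian, norm_smul, mul_pow, Real.norm_eq_abs, sq_abs,
      Real.sq_sqrt ha]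
  simp only [hlin]
  rw [lintegral_lintegral_swap (by fun_prop), ← lintegral_exp_mul_sq_norm_stdGaussian hca]
  refine lintegral_mono fun g => (h.lintegral_exp_inner_le (√a • g)).trans_eq ?_
  rw [norm_smul, mul_pow, Real.norm_eq_abs, sq_abs, Real.sq_sqrt ha, mul_assoc]

theorem measure_le_sq_norm_le (h : IsSubgaussianVector X c μ) (hX : AEMeasurable X μ)
    (hc : 0 < c) {t : ℝ} (ht : 1 ≤ t) (r : ℝ) :
    μ {ω | c * (r * t) ≤ ‖X ω‖ ^ 2} ≤
      ENNReal.ofReal (Real.exp (-(r * (t - 1)) / 2) * t ^ (finrank ℝ E / 2 : ℝ)) := by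
  have hc0 : (0 : ℝ) < c := hc
  have ht0 : 0 < t := by linarith
  -- For `r = finrank ℝ E` this `a` minimizes the Chernoff bound
  -- `exp (-a * c * r * t / 2) * (1 - c * a) ^ (-finrank ℝ E / 2)`.
  set a : ℝ := (1 - t⁻¹) / c with ha
  have ha0 : 0 ≤ a := div_nonneg (sub_nonneg.2 (inv_le_one_of_one_le₀ ht)) hc0.le
  have hca : c * a = 1 - t⁻¹ := by rw [ha]; field_simp
  have hmoment := h.lintegral_exp_mul_sq_norm_le hX ha0 (hca ▸ sub_lt_self _ (inv_pos.2 ht0))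
  rw [hca, sub_sub_cancel, Real.inv_rpow ht0.le, ← Real.rpow_neg ht0.le, neg_neg] at hmoment
  have hthr : a * (c * (r * t)) / 2 = r * (t - 1) / 2 := by rw [ha]; field_simp
  have hexp : 0 < Real.exp (r * (t - 1) / 2) := Real.exp_pos _
  calc μ {ω | c * (r * t) ≤ ‖X ω‖ ^ 2}
    _ ≤ μ {ω | ENNReal.ofReal (Real.exp (r * (t - 1) / 2)) ≤
          ENNReal.ofReal (Real.exp (a * ‖X ω‖ ^ 2 / 2))} := by
      refine measure_mono fun ω hω => ENNReal.ofReal_le_ofReal (Real.exp_le_exp.2 ?_)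
      rw [← hthr]
      gcongr
      exact hω
    _ ≤ (∫⁻ ω, ENNReal.ofReal (Real.exp (a * ‖X ω‖ ^ 2 / 2)) ∂μ) /
          ENNReal.ofReal (Real.exp (r * (t - 1) / 2)) :=
      meas_ge_le_lintegral_div (by fun_prop) (by simpa using hexp) ENNReal.ofReal_ne_top
    _ ≤ ENNReal.ofReal (t ^ (finrank ℝ E / 2 : ℝ)) /
          ENNReal.ofReal (Real.exp (r * (t - 1) / 2)) := by gcongr
    _ = _ := by
      rw [← ENNReal.ofReal_div_of_pos hexp, neg_div, Real.exp_neg, div_eq_inv_mul]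

end IsSubgaussianVector

end Subgaussian

section Sphere

instance (n : ℕ) [NeZero n] : IsProbabilityMeasure (uniformSphere n) := by
  have : NeZero (volume : Measure (Pt n)).toSphere := ⟨Measure.toSphere_ne_zero _⟩
  exact isProbabilityMeasureSMul

instance (n M : ℕ) [NeZero n] : IsProbabilityMeasure (sphereSample n M) := by
  unfold sphereSample; infer_instance

lemma lintegral_stdGaussian_eq_lintegral_uniformSphere {n : ℕ} [NeZero n] {f : Pt n → ℝ≥0∞}
    (hf : Measurable f) :
    ∫⁻ x, f x ∂stdGaussian (Pt n) =
      ∫⁻ u, ∫⁻ r, f (r • (u : Pt n)) ∂(stdGaussian (Pt n)).map norm ∂uniformSphere n := by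
  rw [stdGaussian_eq_withDensity]
  exact lintegral_withDensity_norm_eq_laverage_toSphere volume
    (measurable_gaussianRadialPDF.ennreal_ofReal) hf

theorem isSubgaussianVector_uniformSphere {n : ℕ} (hn : n ≠ 0) :
    IsSubgaussianVector (fun u : sphere (0 : Pt (n + 1)) 1 => (u : Pt (n + 1))) (n : ℝ≥0)⁻¹
      (uniformSphere (n + 1)) := by
  refine .of_lintegral_exp_inner_le (by fun_prop) fun h => ?_
  set γ := stdGaussian (Pt (n + 1))
  set m : ℝ := ∫ x, ‖x‖ ∂γ
  have hm : n ≤ m ^ 2 := by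
    simpa using finrank_sub_one_le_sq_integral_norm_stdGaussian (Pt (n + 1))
  have hm0 : m ≠ 0 := fun h0 => hn (by simpa [h0] using hm)
  have hγ : IsProbabilityMeasure (γ.map norm) :=
    Measure.isProbabilityMeasure_map (by fun_prop)
  have hint : Integrable (fun r : ℝ => r) (γ.map norm) :=
    (integrable_map_measure (by fun_prop) (by fun_prop)).2 (.of_integral_ne_zero hm0)
  have hmean : ∫ r, r ∂γ.map norm = m := integral_map (by fun_prop) (by fun_prop)
  set w := m⁻¹ • h
  have hjensen (u : Pt (n + 1)) : ENNReal.ofReal (Real.exp ⟪h, u⟫) ≤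
      ∫⁻ r, ENNReal.ofReal (Real.exp ⟪w, r • u⟫) ∂γ.map norm := by
    have hexp : ∫ r, ⟪w, r • u⟫ ∂γ.map norm = ⟪h, u⟫ := by
      simp only [real_inner_smul_right, w, real_inner_smul_left, integral_mul_const, hmean]
      field_simp
    simp only [← hexp, real_inner_smul_right]
    exact ofReal_exp_integral_le_lintegral (hint.mul_const _)
  calc ∫⁻ u, ENNReal.ofReal (Real.exp ⟪h, (u : Pt (n + 1))⟫) ∂uniformSphere (n + 1)
    _ ≤ ∫⁻ u, ∫⁻ r, ENNReal.ofReal (Real.exp ⟪w, r • (u : Pt (n + 1))⟫) ∂γ.map norm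
          ∂uniformSphere (n + 1) := lintegral_mono fun u => hjensen u
    _ = ENNReal.ofReal (Real.exp (‖w‖ ^ 2 / 2)) := by
      rw [← lintegral_exp_inner_stdGaussian w,
        lintegral_stdGaussian_eq_lintegral_uniformSphere (by fun_prop)]
    _ ≤ ENNReal.ofReal (Real.exp ((n : ℝ≥0)⁻¹ * ‖h‖ ^ 2 / 2)) := by
      simp only [w, norm_smul, mul_pow, norm_inv, inv_pow, Real.norm_eq_abs, sq_abs]
      push_cast
      gcongr

lemma isSubgaussianVector_sum_sphereSample {n M : ℕ} (hn : n ≠ 0) (T : Finset (Fin M)) :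
    IsSubgaussianVector (fun u => ∑ i ∈ T, (u i : Pt (n + 1))) (T.card / n)
      (sphereSample (n + 1) M) := by
  have hindep : iIndepFun (fun i (u : Fin M → sphere (0 : Pt (n + 1)) 1) => (u i : Pt (n + 1)))
      (sphereSample (n + 1) M) := iIndepFun_pi fun _ => by fun_prop
  have hmp (i : Fin M) : MeasurePreserving (Function.eval i) (sphereSample (n + 1) M)
      (uniformSphere (n + 1)) := measurePreserving_eval _ i
  have hsum := IsSubgaussianVector.sum_of_iIndepFun hindep (s := T) fun i _ =>
    IsSubgaussianVector.of_map (hmp i).aemeasurable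
      ((hmp i).map_eq.symm ▸ isSubgaussianVector_uniformSphere hn)
  simpa [div_eq_mul_inv] using hsum

/-- An upper bound for the probability that the sum of `k` independent uniform unit vectors of `ℝⁿ`
has squared norm at least `k * t`, where `1 ≤ t`. -/
noncomputable def sphereTailBound (n : ℕ) (t : ℝ) : ℝ :=
  Real.exp ((t - 1) / 2) * Real.exp (-(n / 2 * (t - 1 - Real.log t)))

lemma sphereTailBound_pos (n : ℕ) (t : ℝ) : 0 < sphereTailBound n t := by
  unfold sphereTailBound; positivity

theorem sphereSample_le_sq_norm_sum_le {n M : ℕ} (hn : 1 < n) {T : Finset (Fin M)}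
    (hT : T.Nonempty) {t : ℝ} (ht : 1 ≤ t) :
    sphereSample n M {u | T.card * t ≤ ‖∑ i ∈ T, (u i : Pt n)‖ ^ 2} ≤
      ENNReal.ofReal (sphereTailBound n t) := by
  obtain ⟨k, rfl⟩ : ∃ k, n = k + 1 := ⟨n - 1, by omega⟩
  have hk : k ≠ 0 := by omega
  have hc : 0 < (T.card / k : ℝ≥0) := by have := hT.card_pos; positivity
  have htail := (isSubgaussianVector_sum_sphereSample hk T).measure_le_sq_norm_le
    (Measurable.aemeasurable (by fun_prop)) hc ht k
  convert htail using 2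
  · push_cast
    field_simp
  · rw [finrank_euclideanSpace_fin, sphereTailBound, Real.rpow_def_of_pos (by linarith),
      ← Real.exp_add, ← Real.exp_add]
    push_cast
    ring_nf

end Sphere

section DistinctPoints

open scoped Pointwise in
lemma toSphere_singleton {E : Type*} [NormedAddCommGroup E] [NormedSpace ℝ E]
    [FiniteDimensional ℝ E] [MeasurableSpace E] [BorelSpace E] (μ : Measure E)
    [μ.IsAddHaarMeasure] (hE : 1 < finrank ℝ E) (v : sphere (0 : E) 1) : μ.toSphere {v} = 0 := by
  have hspan : (ℝ ∙ (v : E)) ≠ ⊤ := fun h => by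
    have := finrank_span_singleton (K := ℝ) (ne_zero_of_mem_unit_sphere v)
    rw [h, finrank_top] at this
    omega
  have hcone : Ioo (0 : ℝ) 1 • ({(v : E)} : Set E) ⊆ (ℝ ∙ (v : E) : Submodule ℝ E) := by
    rintro _ ⟨r, _, x, rfl, rfl⟩
    exact Submodule.smul_mem _ r (Submodule.mem_span_singleton_self _)
  rw [Measure.toSphere_apply' _ (measurableSet_singleton v), image_singleton,
    measure_mono_null hcone (μ.addHaar_submodule _ hspan), mul_zero]

lemma nullSingletonClass_uniformSphere {n : ℕ} (hn : 1 < n) :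
    NullSingletonClass (uniformSphere n) where
  measure_singleton v := by
    rw [uniformSphere, Measure.smul_apply, toSphere_singleton _ (by simpa using hn), smul_zero]

lemma measure_prod_diagonal {α : Type*} [MeasurableSpace α] [MeasurableEq α] (μ ν : Measure α)
    [SFinite ν] [NullSingletonClass ν] : (μ.prod ν) (diagonal α) = 0 := by
  rw [Measure.measure_prod_null measurableSet_diagonal]
  refine .of_forall fun x => ?_
  have : Prod.mk x ⁻¹' diagonal α = {x} := by ext; simp [eq_comm]
  simp [this]

lemma ae_injective_pi {ι α : Type*} [Fintype ι] [MeasurableSpace α] [MeasurableEq α]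
    (μ : Measure α) [IsProbabilityMeasure μ] [NullSingletonClass μ] :
    ∀ᵐ x ∂Measure.pi fun _ : ι => μ, Function.Injective x := by
  have hne : ∀ i j, i ≠ j → ∀ᵐ x ∂Measure.pi fun _ : ι => μ, x i ≠ x j := by
    intro i j hij
    have hlaw := (indepFun_iff_map_prod_eq_prod_map_map (aemeasurable_id'.eval i)
      (aemeasurable_id'.eval j)).1 <|
      (iIndepFun_pi (μ := fun _ : ι => μ) (X := fun _ a => a) fun _ => aemeasurable_id).indepFun hij
    simp only [(measurePreserving_eval (fun _ : ι => μ) _).map_eq] at hlaw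
    have hdiag := measure_prod_diagonal μ μ
    rw [← hlaw, Measure.map_apply (by fun_prop) measurableSet_diagonal] at hdiag
    simp only [ae_iff, ne_eq, not_not]
    exact hdiag
  filter_upwards [ae_all_iff.2 fun i => ae_all_iff.2 fun j => ae_all_iff.2 fun h => hne i j h]
    with x hx i j hij
  by_contra h
  exact hx i j h hij

end DistinctPoints

section Counting

open Classical in
lemma measure_le_card_filter_mem_le {Ω ι : Type*} [MeasurableSpace Ω] {μ : Measure Ω}
    {s : Finset ι} {A : ι → Set Ω} (hA : ∀ i ∈ s, MeasurableSet (A i)) {p : ℝ≥0∞}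
    (hp : ∀ i ∈ s, μ (A i) ≤ p) {a : ℝ≥0∞} (ha₀ : a ≠ 0) (ha : a ≠ ∞) :
    μ {ω | a ≤ ({i ∈ s | ω ∈ A i} : Finset ι).card} ≤ s.card * p / a := by
  have hcount (ω : Ω) : (({i ∈ s | ω ∈ A i} : Finset ι).card : ℝ≥0∞) =
      ∑ i ∈ s, (A i).indicator 1 ω := by
    simp [indicator_apply]
  have hind : ∀ i ∈ s, Measurable ((A i).indicator (1 : Ω → ℝ≥0∞)) :=
    fun i hi => measurable_one.indicator (hA i hi)
  simp only [hcount]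
  calc μ {ω | a ≤ ∑ i ∈ s, (A i).indicator 1 ω}
    _ ≤ (∫⁻ ω, ∑ i ∈ s, (A i).indicator 1 ω ∂μ) / a :=
      meas_ge_le_lintegral_div (Finset.measurable_fun_sum s hind).aemeasurable ha₀ ha
    _ = (∑ i ∈ s, μ (A i)) / a := by
      rw [lintegral_finsetSum _ hind]
      exact congrArg (· / a) (Finset.sum_congr rfl fun i hi => lintegral_indicator_one (hA i hi))
    _ ≤ s.card * p / a := by
      gcongr
      simpa using Finset.sum_le_card_nsmul s _ p hp

lemma choose_ceil_le (x : ℝ) {k : ℕ} (hk : k ≠ 0) :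
    (⌈x⌉₊.choose k : ℝ) ≤ ⌈x⌉₊ * x ^ (k - 1) := by
  obtain ⟨l, rfl⟩ := Nat.exists_eq_succ_of_ne_zero hk
  rcases hM : ⌈x⌉₊ with _ | m
  · simp
  have hmx : (m : ℝ) ≤ x := (Nat.lt_ceil.1 (by omega)).le
  calc ((m + 1).choose (l + 1) : ℝ)
    _ ≤ (m + 1 : ℕ) * (m ^ l : ℕ) := by
      rw [← Nat.cast_mul, Nat.cast_le]
      calc (m + 1).choose (l + 1)
        _ ≤ (m + 1).choose (l + 1) * (l + 1) := Nat.le_mul_of_pos_right _ l.succ_pos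
        _ = (m + 1) * m.choose l := (Nat.add_one_mul_choose_eq m l).symm
        _ ≤ (m + 1) * m ^ l := Nat.mul_le_mul_left _ (Nat.choose_le_pow m l)
    _ ≤ (m + 1 : ℕ) * x ^ l := by
      push_cast
      gcongr

open Classical in
/-- The index sets of size `L` along which the sum of the vectors `v i` has squared norm at least
`s`. For the points of a spherical code these are the bad `L`-lists, for a suitable `s`. -/
noncomputable def heavyIndexSets {ι E : Type*} [Fintype ι] [NormedAddCommGroup E] (L : ℕ) (s : ℝ)
    (v : ι → E) : Finset (Finset ι) :=
  {T ∈ Finset.univ.powersetCard L | s ≤ ‖∑ i ∈ T, v i‖ ^ 2}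

theorem sphereSample_half_le_card_heavyIndexSets_le {n L : ℕ} (hn : 1 < n) (hL : L ≠ 0) {t : ℝ}
    (ht : 1 ≤ t) {x : ℝ} (hx : 0 < x) :
    sphereSample n ⌈x⌉₊
        {u | (⌈x⌉₊ / 2 : ℝ) ≤ (heavyIndexSets L (L * t) fun i => (u i : Pt n)).card} ≤
      ENNReal.ofReal (2 * x ^ (L - 1) * sphereTailBound n t) := by
  set M := ⌈x⌉₊
  have hp := sphereTailBound_pos n t
  have hM : 0 < (M / 2 : ℝ) := half_pos (Nat.cast_pos.2 (Nat.ceil_pos.2 hx))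
  have hheavy (T : Finset (Fin M)) (hT : T ∈ Finset.univ.powersetCard L) :
      sphereSample n M {u | L * t ≤ ‖∑ i ∈ T, (u i : Pt n)‖ ^ 2} ≤
        ENNReal.ofReal (sphereTailBound n t) := by
    obtain rfl := (Finset.mem_powersetCard.1 hT).2
    exact sphereSample_le_sq_norm_sum_le hn (Finset.card_ne_zero.1 hL) ht
  have hmarkov := measure_le_card_filter_mem_le (fun T _ => measurableSet_le measurable_const
    (by fun_prop)) hheavy (ENNReal.ofReal_pos.2 hM).ne' ENNReal.ofReal_ne_top
  rw [Finset.card_powersetCard, Finset.card_fin, ← ENNReal.ofReal_natCast,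
    ← ENNReal.ofReal_mul (by positivity), ← ENNReal.ofReal_div_of_pos hM] at hmarkov
  refine (measure_mono fun u hu => ?_).trans (hmarkov.trans (ENNReal.ofReal_le_ofReal ?_))
  · simp only [mem_ofPred_eq, ← ENNReal.ofReal_natCast] at hu ⊢
    exact ENNReal.ofReal_le_ofReal hu
  · rw [div_le_iff₀ hM]
    calc (M.choose L : ℝ) * sphereTailBound n t
      _ ≤ M * x ^ (L - 1) * sphereTailBound n t := by
        gcongr
        exact choose_ceil_le x hL
      _ = 2 * x ^ (L - 1) * sphereTailBound n t * (M / 2) := by ring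

end Counting

section Lists

variable {n L : ℕ} {P N : ℝ} {C C' : Set (Pt n)}

lemma avgRadSq_eq {S : Finset (Pt n)} (hS : S.Nonempty) :
    avgRadSq S = (S.card : ℝ)⁻¹ * ∑ x ∈ S, ‖x‖ ^ 2 - ‖centroid S‖ ^ 2 := by
  have hc : (S.card : ℝ) ≠ 0 := Nat.cast_ne_zero.2 hS.card_ne_zero
  have hsum : ∑ x ∈ S, x = (S.card : ℝ) • centroid S := (smul_inv_smul₀ hc _).symm
  have hvar : ∑ x ∈ S, ‖x - centroid S‖ ^ 2 = ∑ x ∈ S, ‖x‖ ^ 2 - S.card * ‖centroid S‖ ^ 2 := by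
    simp_rw [norm_sub_sq_real]
    rw [Finset.sum_add_distrib, Finset.sum_sub_distrib, ← Finset.mul_sum, ← sum_inner, hsum,
      real_inner_smul_left, real_inner_self_eq_norm_sq, Finset.sum_const, nsmul_eq_mul]
    ring
  rw [avgRadSq, hvar, mul_sub, inv_mul_cancel_left₀ hc]

lemma finite_lists (hC : C.Finite) : (lists L C).Finite := by
  refine hC.toFinset.powerset.finite_toSet.subset fun S hS => ?_
  simpa [← Finset.coe_subset] using hS.1

lemma lt_codeAvgRadSq_iff (hC : C.Finite) {r : ℝ} :
    (r : EReal) < codeAvgRadSq L C ↔ ∀ S ∈ lists L C, r < avgRadSq S := by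
  have hinf := (finite_lists (L := L) hC).toFinset.inf_eq_iInf fun S => (avgRadSq S : EReal)
  simp only [Finite.mem_toFinset] at hinf
  rw [codeAvgRadSq, ← hinf, Finset.lt_inf_iff (EReal.coe_lt_top r)]
  simp only [Finite.mem_toFinset, EReal.coe_lt_coe_iff]

lemma IsExpurgation.subset (h : IsExpurgation N L C C') : C' ⊆ C := by
  obtain ⟨c, -, rfl⟩ := h
  exact sdiff_subset

lemma IsExpurgation.badLists_eq_empty (h : IsExpurgation N L C C') : badLists N L C' = ∅ := by
  obtain ⟨c, hc, rfl⟩ := h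
  refine eq_empty_of_forall_notMem fun S hS => ?_
  have hSbad : S ∈ badLists N L C := ⟨⟨hS.1.1.trans sdiff_subset, hS.1.2⟩, hS.2⟩
  exact (hS.1.1 (hc S hSbad)).2 (mem_image_of_mem c hSbad)

lemma IsExpurgation.isAvgRadListDecodable (h : IsExpurgation N L C C') (hC : C.Finite)
    (hball : C ⊆ closedBall 0 √(n * P)) : IsAvgRadListDecodable P N L C' := by
  refine ⟨h.subset.trans hball, (lt_codeAvgRadSq_iff (hC.subset h.subset)).2 fun S hS => ?_⟩
  by_contra! hle
  exact (h.badLists_eq_empty ▸ ⟨hS, hle⟩ : S ∈ (∅ : Set _))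

lemma IsExpurgation.ncard_le (h : IsExpurgation N L C C') (hC : C.Finite) :
    C.ncard ≤ C'.ncard + (badLists N L C).ncard := by
  have hbad : (badLists N L C).Finite := (finite_lists hC).subset (sep_subset _ _)
  obtain ⟨c, -, rfl⟩ := h
  have hdiff := le_ncard_sdiff (c '' badLists N L C) C (hbad.image c)
  have himage := ncard_image_le (f := c) hbad
  omega

lemma exists_isExpurgation (N : ℝ) (hL : L ≠ 0) (C : Set (Pt n)) :
    ∃ C', IsExpurgation N L C C' := by
  have hne (S : Finset (Pt n)) (hS : S ∈ badLists N L C) : ∃ x, x ∈ S :=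
    Finset.card_ne_zero.1 (hS.1.2.symm ▸ hL)
  choose! c hc using hne
  exact ⟨_, c, hc, rfl⟩

end Lists

section SphericalCode

variable {n M L : ℕ} {P N : ℝ} {C' : Set (Pt n)} {u : Fin M → sphere (0 : Pt n) 1}

lemma finite_sphericalCode : (sphericalCode P u).Finite := finite_range _

lemma sphericalCode_subset_closedBall : sphericalCode P u ⊆ closedBall 0 √(n * P) := by
  rintro _ ⟨i, rfl⟩
  simp [norm_smul, abs_of_nonneg (Real.sqrt_nonneg _)]

lemma injective_smul_sphere (hnP : 0 < n * P) (hu : Function.Injective u) :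
    Function.Injective fun i => √(n * P) • (u i : Pt n) :=
  (smul_right_injective _ (Real.sqrt_pos.2 hnP).ne').comp (Subtype.val_injective.comp hu)

lemma ncard_sphericalCode (hnP : 0 < n * P) (hu : Function.Injective u) :
    (sphericalCode P u).ncard = M := by
  rw [sphericalCode, ← image_univ, ncard_image_of_injective _ (injective_smul_sphere hnP hu),
    ncard_univ, Nat.card_fin]

open Classical in
lemma avgRadSq_image_smul_sphere (hnP : 0 < n * P) (hu : Function.Injective u)
    {T : Finset (Fin M)} (hT : T.Nonempty) :
    avgRadSq (T.image fun i => √(n * P) • (u i : Pt n)) =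
      n * P * (1 - ‖∑ i ∈ T, (u i : Pt n)‖ ^ 2 / T.card ^ 2) := by
  have hinj := injective_smul_sphere hnP hu
  have hT0 : (T.card : ℝ) ≠ 0 := Nat.cast_ne_zero.2 hT.card_ne_zero
  rw [avgRadSq_eq (hT.image _), centroid, Finset.card_image_of_injective _ hinj,
    Finset.sum_image hinj.injOn, Finset.sum_image hinj.injOn, ← Finset.smul_sum]
  simp only [norm_smul, mul_pow, norm_eq_of_mem_sphere, Real.norm_eq_abs, sq_abs, one_pow, inv_pow,
    Real.sq_sqrt hnP.le, Finset.sum_const, nsmul_eq_mul]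
  field_simp

open Classical in
lemma badLists_sphericalCode_subset (hn : n ≠ 0) (hP : 0 < P) (hL : L ≠ 0)
    (hu : Function.Injective u) :
    badLists N L (sphericalCode P u) ⊆
      (fun T : Finset (Fin M) => T.image fun i => √(n * P) • (u i : Pt n)) ''
        heavyIndexSets L (L * (L * (P - N) / P)) fun i => (u i : Pt n) := by
  rintro S ⟨⟨hSC, hSL⟩, hbad⟩
  have hnP : 0 < n * P := by positivity
  rw [sphericalCode, ← image_univ] at hSC
  obtain ⟨T, -, rfl⟩ := Finset.subset_set_image_iff.1 hSC
  rw [Finset.card_image_of_injective _ (injective_smul_sphere hnP hu)] at hSL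
  subst hSL
  rw [avgRadSq_image_smul_sphere hnP hu (Finset.card_ne_zero.1 hL), mul_assoc,
    mul_le_mul_iff_right₀ (by positivity), mul_one_sub, sub_le_comm, mul_div_assoc',
    le_div_iff₀ (by positivity)] at hbad
  refine ⟨T, ?_, rfl⟩
  simp only [heavyIndexSets, Finset.coe_filter, Finset.mem_powersetCard, Finset.subset_univ,
    true_and, mem_ofPred_eq]
  rw [mul_div_assoc', div_le_iff₀ hP]
  linarith

theorem IsExpurgation.le_ncard_of_sphericalCode (h : IsExpurgation N L (sphericalCode P u) C')
    (hn : n ≠ 0) (hP : 0 < P) (hL : L ≠ 0) (hu : Function.Injective u) :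
    M ≤ C'.ncard + (heavyIndexSets L (L * (L * (P - N) / P)) fun i => (u i : Pt n)).card := by
  classical
  set H := heavyIndexSets L (L * (L * (P - N) / P)) fun i => (u i : Pt n)
  have hbad : (badLists N L (sphericalCode P u)).ncard ≤ H.card :=
    calc _ ≤ _ := ncard_le_ncard (badLists_sphericalCode_subset hn hP hL hu)
          (H.finite_toSet.image _)
      _ ≤ (H : Set (Finset (Fin M))).ncard := ncard_image_le H.finite_toSet
      _ = H.card := ncard_coe_finset H
  calc M = (sphericalCode P u).ncard := (ncard_sphericalCode (by positivity) hu).symm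
    _ ≤ C'.ncard + (badLists N L (sphericalCode P u)).ncard := h.ncard_le finite_sphericalCode
    _ ≤ C'.ncard + H.card := by gcongr

end SphericalCode

section Capacity

variable {P N : ℝ} {L : ℕ}

lemma le_rate_of_exp_le_ncard {n : ℕ} (hn : n ≠ 0) {R : ℝ} {C : Set (Pt n)}
    (h : Real.exp (n * R) ≤ C.ncard) : (R : EReal) ≤ rate C := by
  have hn0 : (0 : ℝ) < n := by positivity
  have hpos : (0 : ℝ) < C.ncard := (Real.exp_pos _).trans_le h
  have hfin : C.Finite := finite_of_ncard_pos (Nat.cast_pos.1 hpos)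
  have hlog : ENNReal.log (C.encard : ℝ≥0∞) = (Real.log C.ncard : EReal) := by
    rw [← hfin.cast_ncard_eq, ENat.toENNReal_coe, ← ENNReal.ofReal_natCast,
      ENNReal.log_ofReal_of_pos hpos]
  rw [rate, hlog, ← EReal.coe_natCast, ← EReal.coe_div, EReal.coe_le_coe_iff, le_div_iff₀' hn0]
  exact (Real.le_log_iff_exp_le hpos).2 h

lemma le_avgRadCapacity_of_eventually {R a : ℝ} (ha : 0 < a)
    (h : ∀ᶠ n : ℕ in atTop, ∃ C : Set (Pt n),
      IsAvgRadListDecodable P N L C ∧ a * Real.exp (n * R) ≤ C.ncard) :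
    (R : EReal) ≤ avgRadCapacity P N L := by
  have hlim : Tendsto (fun n : ℕ => R + Real.log a / n) atTop (𝓝 R) := by
    simpa using (tendsto_const_div_atTop_nhds_zero_nat (Real.log a)).const_add R
  refine EReal.ge_of_forall_gt_iff_ge.1 fun R' hR' => ?_
  refine le_limsup_of_frequently_le (Eventually.frequently ?_) (by isBoundedDefault)
  filter_upwards [h, hlim.eventually_const_lt (EReal.coe_lt_coe_iff.1 hR'), eventually_ne_atTop 0]
    with n ⟨C, hC, hcard⟩ hn hn0
  have hn0' : (n : ℝ) ≠ 0 := Nat.cast_ne_zero.2 hn0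
  have hrate : ((R + Real.log a / n : ℝ) : EReal) ≤ rate C := by
    refine le_rate_of_exp_le_ncard hn0 (le_of_eq_of_le ?_ hcard)
    rw [mul_add, mul_div_cancel₀ _ hn0', Real.exp_add, Real.exp_log ha, mul_comm]
  exact (EReal.coe_le_coe_iff.2 hn.le).trans (hrate.trans (le_iSup₂_of_le C hC le_rfl))

/-- The lower bound `B` on the `(P, N, L-1)`-average-radius list-decoding capacity. -/
noncomputable def rateBound (P N : ℝ) (L : ℕ) : ℝ :=
  (1 / 2 : ℝ) * (1 - L * N / (((L : ℝ) - 1) * P)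
    - 1 / ((L : ℝ) - 1) * Real.log (L * (P - N) / P))

lemma rateBound_eq (hP : P ≠ 0) (hL : 1 < L) {t : ℝ} (ht : t = L * (P - N) / P) :
    rateBound P N L = (t - 1 - Real.log t) / 2 / (L - 1) := by
  have hL' : (L : ℝ) - 1 ≠ 0 := sub_ne_zero.2 (Nat.cast_ne_one.2 hL.ne')
  have hN : L * N / ((L - 1) * P) = (L - t) / (L - 1) := by rw [ht]; field_simp; ring
  rw [rateBound, hN, ← ht]
  field_simp
  ring

lemma one_le_mul_sub_div (hP : 0 < P) (hL : 0 < L) (hNP : N / P ≤ ((L : ℝ) - 1) / L) :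
    1 ≤ L * (P - N) / P := by
  rw [div_le_div_iff₀ hP (Nat.cast_pos.2 hL)] at hNP
  rw [le_div_iff₀ hP]
  linarith

lemma one_sub_le_sphereSample_expurgation {n : ℕ} (hn : 1 < n) (hP : 0 < P) (hL : L ≠ 0)
    {t : ℝ} (ht : t = L * (P - N) / P) (ht1 : 1 ≤ t) {x : ℝ} (hx : 0 < x) :
    1 - ENNReal.ofReal (2 * x ^ (L - 1) * sphereTailBound n t) ≤
      sphereSample n ⌈x⌉₊ {u | ∀ C', IsExpurgation N L (sphericalCode P u) C' →
        IsAvgRadListDecodable P N L C' ∧ (⌈x⌉₊ : ℝ) / 2 ≤ C'.ncard} := by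
  have : NeZero n := ⟨by omega⟩
  have := nullSingletonClass_uniformSphere hn
  set H := {u : Fin ⌈x⌉₊ → sphere (0 : Pt n) 1 |
    (⌈x⌉₊ / 2 : ℝ) ≤ (heavyIndexSets L (L * t) fun i => (u i : Pt n)).card}
  have hcompl : 1 - sphereSample n ⌈x⌉₊ H ≤ sphereSample n ⌈x⌉₊ Hᶜ := by
    rw [tsub_le_iff_left, ← measure_univ (μ := sphereSample n ⌈x⌉₊), ← union_compl_self H]
    exact measure_union_le H Hᶜ
  refine (tsub_le_tsub_left (sphereSample_half_le_card_heavyIndexSets_le hn hL ht1 hx) 1).trans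
    (hcompl.trans (measure_mono_ae ?_))
  filter_upwards [ae_injective_pi (ι := Fin ⌈x⌉₊) (uniformSphere n)] with u hinj hu C' hC'
  refine ⟨hC'.isAvgRadListDecodable finite_sphericalCode sphericalCode_subset_closedBall, ?_⟩
  have hfew : (heavyIndexSets L (L * t) fun i => (u i : Pt n)).card < (⌈x⌉₊ / 2 : ℝ) := not_le.1 hu
  have hcard := hC'.le_ncard_of_sphericalCode (by omega) hP hL hinj
  rw [← ht, ← Nat.cast_le (α := ℝ), Nat.cast_add] at hcard
  linarith

lemma tendsto_pow_mul_sphereTailBound {l : ℕ} {R t : ℝ} (h : l * R < (t - 1 - Real.log t) / 2) :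
    Tendsto (fun n : ℕ => 2 * Real.exp (n * R) ^ l * sphereTailBound n t) atTop (𝓝 0) := by
  have hexp (n : ℕ) : 2 * Real.exp (n * R) ^ l * sphereTailBound n t =
      2 * Real.exp ((t - 1) / 2) * Real.exp (-(n * ((t - 1 - Real.log t) / 2 - l * R))) := by
    have hadd : -(n * ((t - 1 - Real.log t) / 2 - l * R)) =
        l * (n * R) + -(n / 2 * (t - 1 - Real.log t)) := by ring
    rw [hadd, Real.exp_add, sphereTailBound, Real.exp_nat_mul (n * R)]
    ring
  have hlim : Tendsto (fun n : ℕ => (n : ℝ) * ((t - 1 - Real.log t) / 2 - l * R)) atTop atTop :=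
    tendsto_natCast_atTop_atTop.atTop_mul_const (sub_pos.2 h)
  simpa [hexp] using (Real.tendsto_exp_neg_atTop_nhds_zero.comp hlim).const_mul
    (2 * Real.exp ((t - 1) / 2))

theorem tendsto_sphereSample_expurgation (hP : 0 < P) (hL : 2 ≤ L)
    (hNP : N / P ≤ ((L : ℝ) - 1) / L) {R : ℝ} (hR : R < rateBound P N L) :
    Tendsto (fun n : ℕ => sphereSample n ⌈Real.exp (n * R)⌉₊
      {u | ∀ C', IsExpurgation N L (sphericalCode P u) C' → IsAvgRadListDecodable P N L C' ∧
        (⌈Real.exp (n * R)⌉₊ : ℝ) / 2 ≤ C'.ncard}) atTop (𝓝 1) := by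
  obtain ⟨t, ht⟩ : ∃ t, t = L * (P - N) / P := ⟨_, rfl⟩
  have ht1 : 1 ≤ t := ht ▸ one_le_mul_sub_div hP (by omega) hNP
  have hexponent : (L - 1 : ℕ) * R < (t - 1 - Real.log t) / 2 := by
    rwa [rateBound_eq hP.ne' hL ht, lt_div_iff₀' (sub_pos.2 (Nat.one_lt_cast.2 hL)),
      ← Nat.cast_pred (by omega)] at hR
  have hε := tendsto_pow_mul_sphereTailBound hexponent
  have hlower : Tendsto (fun n : ℕ => 1 - ENNReal.ofReal (2 * Real.exp (n * R) ^ (L - 1) *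
      sphereTailBound n t)) atTop (𝓝 1) := by
    simpa using ENNReal.Tendsto.sub (tendsto_const_nhds (x := (1 : ℝ≥0∞)))
      (ENNReal.tendsto_ofReal hε) (.inl ENNReal.one_ne_top)
  refine tendsto_of_tendsto_of_tendsto_of_le_of_le' hlower tendsto_const_nhds ?_ ?_
  · filter_upwards [eventually_gt_atTop 1] with n hn
    exact one_sub_le_sphereSample_expurgation hn hP (by omega) ht ht1 (Real.exp_pos _)
  · filter_upwards [eventually_ne_atTop 0] with n hn
    have : NeZero n := ⟨hn⟩
    exact prob_le_one

theorem rateBound_le_avgRadCapacity (hP : 0 < P) (hL : 2 ≤ L)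
    (hNP : N / P ≤ ((L : ℝ) - 1) / L) : (rateBound P N L : EReal) ≤ avgRadCapacity P N L := by
  refine EReal.ge_of_forall_gt_iff_ge.1 fun R hR => le_avgRadCapacity_of_eventually one_half_pos ?_
  have hprob := tendsto_sphereSample_expurgation hP hL hNP (EReal.coe_lt_coe_iff.1 hR)
  filter_upwards [hprob.eventually_const_lt zero_lt_one] with n hn
  obtain ⟨u, hu⟩ := nonempty_of_measure_ne_zero hn.ne'
  obtain ⟨C', hC'⟩ := exists_isExpurgation N (by omega : L ≠ 0) (sphericalCode P u)
  obtain ⟨hdec, hhalf⟩ := hu C' hC'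
  refine ⟨C', hdec, le_trans ?_ hhalf⟩
  linarith [Nat.le_ceil (Real.exp (n * R))]

end Capacity

end MultiplePacking

theorem mainTheorem9 (P N : ℝ) (L : ℕ) (hP : 0 < P) (hN : 0 < N) (hL : 2 ≤ L)
    (hNP : N / P ≤ ((L : ℝ) - 1) / L) :
    -- the lower bound on the capacity
    (((1 / 2 : ℝ) * (1 - L * N / (((L : ℝ) - 1) * P)
        - 1 / ((L : ℝ) - 1) * Real.log (L * (P - N) / P)) : ℝ) : EReal)
      ≤ MultiplePacking.avgRadCapacity P N L ∧
    -- every smaller rate is achieved, with probability tending to one, by expurgated random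
    -- spherical codes
    ∀ R : ℝ, R < (1 / 2 : ℝ) * (1 - L * N / (((L : ℝ) - 1) * P)
        - 1 / ((L : ℝ) - 1) * Real.log (L * (P - N) / P)) →
      Tendsto (fun n : ℕ =>
        MultiplePacking.sphereSample n ⌈Real.exp (n * R)⌉₊
          {u | ∀ C' : Set (MultiplePacking.Pt n),
            MultiplePacking.IsExpurgation N L (MultiplePacking.sphericalCode P u) C' →
              MultiplePacking.IsAvgRadListDecodable P N L C' ∧
              (⌈Real.exp (n * R)⌉₊ : ℝ) / 2 ≤ (C'.ncard : ℝ)})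
        atTop (𝓝 1) :=
  ⟨MultiplePacking.rateBound_le_avgRadCapacity hP hL hNP,
    fun _ hR => MultiplePacking.tendsto_sphereSample_expurgation hP hL hNP hR⟩
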